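/- Let $q\ge 2$ and let $(e_n)_{n\in\mathbb Z}$ (the watermark of a multi-input system) be i.i.d. random vectors in $\mathbb R^q$ with mean zero, covariance matrix $\Sigma_e=\mathbb E[e_ne_n^\top]$, and $\|e_n\|\le K_e$ almost surely (Euclidean norm), for a constant $K_e$. For integers $k'\ge 0$ and $N\ge 1$ let $$\Phi^{(3)}_N=\frac1N\sum_{n=0}^{N-1}\bigl(e_{n-k'-1}e_{n-k'-1}^\top-\Sigma_e\bigr),\qquad c^{(3)}_N=\Bigl\|\sum_{k=0}^{N-1}\Bigl((K_e^2\mathbb I-\Sigma_e)^2+\mathbb E\bigl[(e_ke_k^\top)^2\bigr]-\Sigma_e^2\Bigr)\Bigr\|,$$ where $\|\cdot\|$ is the spectral norm of matrices. Then for every $k'\ge0$, every $N\ge 1$ and every $t\ge 0$, $$\mathrm P\bigl(\|\Phi^{(3)}_N\|\ge t\bigr)\le 2q\,\exp\!\Bigl(-\frac{N^2t^2}{c^{(3)}_N}\Bigr),$$ where, if $c^{(3)}_N=0$, the exponential is read as $0$ for $t>0$ and as $1$ for $t=0$. -/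

import Mathlib

open MeasureTheory ProbabilityTheory
open scoped Matrix Matrix.Norms.L2Operator

/- With the scope `Matrix.Norms.L2Operator` open, `‖A‖` for a real matrix `A` is its spectral norm
(the largest singular value). -/

noncomputable section

namespace DynamicWatermark

/-- The rank-one matrix `v vᵀ`. -/
def outer {q : ℕ} (v : EuclideanSpace ℝ (Fin q)) : Matrix (Fin q) (Fin q) ℝ :=
  Matrix.of fun i j => v i * v j

/-- The entrywise expectation `𝔼[M]` of a random matrix `M`. -/
def matrixExp {Ω : Type*} [MeasurableSpace Ω] (P : Measure Ω) {q : ℕ}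
    (M : Ω → Matrix (Fin q) (Fin q) ℝ) : Matrix (Fin q) (Fin q) ℝ :=
  Matrix.of fun i j => ∫ ω, M ω i j ∂P

/-- The covariance matrix of a random vector `X`. -/
def covMatrix {Ω : Type*} [MeasurableSpace Ω] (P : Measure Ω) {q : ℕ}
    (X : Ω → EuclideanSpace ℝ (Fin q)) : Matrix (Fin q) (Fin q) ℝ :=
  Matrix.of fun i j => covariance (fun ω => X ω i) (fun ω => X ω j) P

/-- The centered empirical covariance
`Φ⁽³⁾_N = (1/N) ∑_{n=0}^{N-1} (e_{n-k'-1} e_{n-k'-1}ᵀ - Σ_e)` of the watermark,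
where `Σ_e` is the common covariance matrix of the `e_n`. -/
def Phi3 {Ω : Type*} [MeasurableSpace Ω] (P : Measure Ω) {q : ℕ}
    (e : ℤ → Ω → EuclideanSpace ℝ (Fin q)) (k' N : ℕ) (ω : Ω) : Matrix (Fin q) (Fin q) ℝ :=
  (1 / (N : ℝ)) • ∑ n ∈ Finset.range N,
    (outer (e ((n : ℤ) - (k' : ℤ) - 1) ω) - covMatrix P (e 0))

/-- The constant
`c⁽³⁾_N = ‖∑_{k=0}^{N-1} ((K_e² I - Σ_e)² + 𝔼[(e_k e_kᵀ)²] - Σ_e²)‖`. -/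
def c3 {Ω : Type*} [MeasurableSpace Ω] (P : Measure Ω) {q : ℕ}
    (e : ℤ → Ω → EuclideanSpace ℝ (Fin q)) (Ke : ℝ) (N : ℕ) : ℝ :=
  ‖∑ k ∈ Finset.range N,
    ((Ke ^ 2 • (1 : Matrix (Fin q) (Fin q) ℝ) - covMatrix P (e 0)) ^ 2
      + matrixExp P (fun ω => outer (e (k : ℤ) ω) ^ 2) - covMatrix P (e 0) ^ 2)‖

end DynamicWatermark

end

/-!
Golden–Thompson does not control three or more non-commuting exponentials, so independence is
exploited through Lieb's theorem: `A ↦ tr exp (H + log A)` is concave on positive definite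
matrices. Relative entropy is an integral of `χ²`-type divergences, each of which is a supremum of
functionals of the pair `(A, B)` that are linear in the pair, hence is jointly convex; Lieb's
theorem follows from the Gibbs variational principle. Jensen's inequality then bounds
`𝔼 tr exp (H + X)` by `tr exp (H + log 𝔼 B)` whenever `X ≤ log B`, and such bounds add up over
independent summands. Taking for `B` the secant of the exponential on the interval that contains
the spectrum of `X` gives a matrix Hoeffding inequality without loss in the exponent, so that
`eₙ eₙᵀ ∈ [0, K²]` yields the tail `2 q exp (-2 N t² / K⁴)`.

It remains to compare the exponents. Expanding the squares,
`c⁽³⁾_N = N ‖𝔼 (K² - e eᵀ)²‖`, and since `K² - e eᵀ` is `K²` on the orthogonal complement of `e`,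
the trace of this mean is at least `(q - 1) K⁴`. Hence `c⁽³⁾_N ≥ N (1 - 1 / q) K⁴ ≥ N K⁴ / 2`.
-/

namespace MatrixConcentration

open Filter Topology
open NormedSpace (exp)
open scoped MatrixOrder

/-! ### Spectral decompositions and traces -/

section Spectral

variable {n : Type*} [Fintype n] [DecidableEq n] {A B : Matrix n n ℝ}

/-- The matrix `Uᵀ Z V` of `Z` with respect to the orthonormal eigenbases `U` of `A` and `V` of
`B`. -/
noncomputable def eigenCoeff (hA : A.IsHermitian) (hB : B.IsHermitian) (Z : Matrix n n ℝ) :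
    Matrix n n ℝ :=
  (hA.eigenvectorUnitary : Matrix n n ℝ)ᵀ * Z * (hB.eigenvectorUnitary : Matrix n n ℝ)

theorem eigenvectorUnitary_transpose_mul_self (hA : A.IsHermitian) :
    (hA.eigenvectorUnitary : Matrix n n ℝ)ᵀ * (hA.eigenvectorUnitary : Matrix n n ℝ) = 1 := by
  simpa only [Matrix.star_eq_conjTranspose, Matrix.conjTranspose_eq_transpose_of_trivial] using
    Unitary.coe_star_mul_self hA.eigenvectorUnitary

theorem surjective_eigenCoeff (hA : A.IsHermitian) (hB : B.IsHermitian) :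
    Function.Surjective (eigenCoeff hA hB) := fun W => by
  let U := (hA.eigenvectorUnitary : Matrix n n ℝ)
  let V := (hB.eigenvectorUnitary : Matrix n n ℝ)
  refine ⟨U * W * Vᵀ, ?_⟩
  calc Uᵀ * (U * W * Vᵀ) * V = (Uᵀ * U) * W * (Vᵀ * V) := by simp only [Matrix.mul_assoc]
    _ = W := by
      rw [eigenvectorUnitary_transpose_mul_self, eigenvectorUnitary_transpose_mul_self,
        Matrix.one_mul, Matrix.mul_one]

theorem cfc_eq_mul_diagonal_mul_transpose (hA : A.IsHermitian) (f : ℝ → ℝ) :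
    cfc f A = (hA.eigenvectorUnitary : Matrix n n ℝ) *
      Matrix.diagonal (fun i => f (hA.eigenvalues i)) *
      (hA.eigenvectorUnitary : Matrix n n ℝ)ᵀ := by
  rw [hA.cfc_eq, Matrix.IsHermitian.cfc, Unitary.conjStarAlgAut_apply]
  simp [Matrix.star_eq_conjTranspose, Function.comp_def]

theorem trace_cfc (hA : A.IsHermitian) (f : ℝ → ℝ) :
    (cfc f A).trace = ∑ i, f (hA.eigenvalues i) := by
  rw [cfc_eq_mul_diagonal_mul_transpose hA, Matrix.trace_mul_comm, ← Matrix.mul_assoc,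
    eigenvectorUnitary_transpose_mul_self, Matrix.one_mul, Matrix.trace_diagonal]

theorem trace_cfc_mul_cfc (hA : A.IsHermitian) (hB : B.IsHermitian) (f g : ℝ → ℝ)
    (Y Z : Matrix n n ℝ) :
    (cfc f A * Y * cfc g B * Zᵀ).trace =
      ∑ i, ∑ j, f (hA.eigenvalues i) * g (hB.eigenvalues j) *
        (eigenCoeff hA hB Y i j * eigenCoeff hA hB Z i j) := by
  let D := Matrix.diagonal fun i => f (hA.eigenvalues i)
  let E := Matrix.diagonal fun i => g (hB.eigenvalues i)
  have rotate : (cfc f A * Y * cfc g B * Zᵀ).trace =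
      (D * eigenCoeff hA hB Y * (E * (eigenCoeff hA hB Z)ᵀ)).trace := by
    rw [cfc_eq_mul_diagonal_mul_transpose hA, cfc_eq_mul_diagonal_mul_transpose hB]
    simp only [D, E, eigenCoeff, Matrix.transpose_mul, Matrix.transpose_transpose,
      Matrix.mul_assoc]
    rw [Matrix.trace_mul_comm]
    simp only [Matrix.mul_assoc]
  rw [rotate, Matrix.trace]
  refine Finset.sum_congr rfl fun i _ => ?_
  rw [Matrix.diag_apply, Matrix.mul_apply]
  refine Finset.sum_congr rfl fun j _ => ?_
  rw [Matrix.diagonal_mul, Matrix.diagonal_mul, Matrix.transpose_apply]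
  ring

theorem trace_mul_mul_transpose_left (hA : A.IsHermitian) (hB : B.IsHermitian)
    (Y Z : Matrix n n ℝ) :
    (A * Y * Zᵀ).trace = ∑ i, ∑ j, hA.eigenvalues i *
      (eigenCoeff hA hB Y i j * eigenCoeff hA hB Z i j) := by
  simpa only [cfc_id' ℝ A hA.isSelfAdjoint, cfc_const_one ℝ B hB.isSelfAdjoint, Matrix.mul_one,
    mul_one] using trace_cfc_mul_cfc hA hB (fun x => x) (fun _ => 1) Y Z

theorem trace_mul_mul_transpose_right (hA : A.IsHermitian) (hB : B.IsHermitian)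
    (Y Z : Matrix n n ℝ) :
    (Y * B * Zᵀ).trace = ∑ i, ∑ j, hB.eigenvalues j *
      (eigenCoeff hA hB Y i j * eigenCoeff hA hB Z i j) := by
  simpa only [cfc_id' ℝ B hB.isSelfAdjoint, cfc_const_one ℝ A hA.isSelfAdjoint, Matrix.one_mul,
    one_mul] using trace_cfc_mul_cfc hA hB (fun _ => 1) (fun x => x) Y Z

omit [DecidableEq n] in
theorem trace_mul_nonneg (hA : A.PosSemidef) (hB : B.PosSemidef) : 0 ≤ (A * B).trace := by
  classical
  have h := trace_cfc_mul_cfc hA.1 hB.1 (fun x => x) (fun x => x) 1 1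
  simp only [cfc_id' ℝ A hA.1.isSelfAdjoint, cfc_id' ℝ B hB.1.isSelfAdjoint, Matrix.mul_one,
    Matrix.transpose_one] at h
  rw [h]
  exact Finset.sum_nonneg fun i _ => Finset.sum_nonneg fun j _ =>
    mul_nonneg (mul_nonneg (hA.eigenvalues_nonneg i) (hB.eigenvalues_nonneg j))
      (mul_self_nonneg _)

end Spectral

/-! ### Joint convexity of the relative entropy -/

section ScalarEntropy

variable {x y : ℝ}

theorem hasDerivAt_entropyPrimitive (hx : 0 < x) (hy : 0 < y) {s : ℝ} (hs : 0 ≤ s) :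
    HasDerivAt (fun s => x * Real.log ((1 + s) * y / (x + s * y)) - (y - x) / (1 + s))
      (s / (1 + s) ^ 2 * ((x - y) ^ 2 / (x + s * y))) s := by
  have h1 : 0 < 1 + s := by positivity
  have h2 : 0 < x + s * y := by positivity
  have num : HasDerivAt (fun s : ℝ => (1 + s) * y) y s := by
    simpa using ((hasDerivAt_id s).const_add 1).mul_const y
  have den : HasDerivAt (fun s : ℝ => x + s * y) y s := by
    simpa using ((hasDerivAt_id s).mul_const y).const_add x
  have ratio_ne : (1 + s) * y / (x + s * y) ≠ 0 := by positivity
  have log_part := ((num.div den h2.ne').log ratio_ne).const_mul x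
  have rational_part :=
    (hasDerivAt_const s (y - x)).div ((hasDerivAt_id s).const_add 1) h1.ne'
  refine (log_part.sub rational_part).congr_deriv ?_
  simp only [id_eq, Pi.div_apply]
  field_simp
  ring

theorem tendsto_entropyPrimitive (hy : 0 < y) :
    Tendsto (fun s => x * Real.log ((1 + s) * y / (x + s * y)) - (y - x) / (1 + s))
      atTop (𝓝 0) := by
  have den : Tendsto (fun s : ℝ => x + s * y) atTop atTop :=
    tendsto_atTop_add_const_left _ _ (tendsto_id.atTop_mul_const hy)
  have ratio : Tendsto (fun s : ℝ => (1 + s) * y / (x + s * y)) atTop (𝓝 1) := by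
    have h : Tendsto (fun s : ℝ => 1 + (y - x) / (x + s * y)) atTop (𝓝 (1 + 0)) :=
      tendsto_const_nhds.add (tendsto_const_nhds.div_atTop den)
    rw [add_zero] at h
    refine h.congr' ?_
    filter_upwards [den.eventually_gt_atTop 0] with s hs
    rw [eq_div_iff hs.ne', add_mul, div_mul_cancel₀ _ hs.ne']
    ring
  have rational_part : Tendsto (fun s : ℝ => (y - x) / (1 + s)) atTop (𝓝 0) :=
    tendsto_const_nhds.div_atTop (tendsto_atTop_add_const_left _ _ tendsto_id)
  have log_part := ((Real.continuousAt_log one_ne_zero).tendsto.comp ratio).const_mul x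
  simpa using log_part.sub rational_part

theorem integrableOn_entropyIntegrand (hx : 0 < x) (hy : 0 < y) :
    IntegrableOn (fun s => s / (1 + s) ^ 2 * ((x - y) ^ 2 / (x + s * y))) (Set.Ioi 0) :=
  integrableOn_Ioi_deriv_of_nonneg' (fun _ hs => hasDerivAt_entropyPrimitive hx hy hs)
    (fun s (hs : 0 < s) => by positivity) (tendsto_entropyPrimitive hy)

theorem integral_entropyIntegrand (hx : 0 < x) (hy : 0 < y) :
    ∫ s in Set.Ioi (0 : ℝ), s / (1 + s) ^ 2 * ((x - y) ^ 2 / (x + s * y)) =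
      x * Real.log x - x * Real.log y - x + y := by
  rw [integral_Ioi_of_hasDerivAt_of_nonneg' (fun _ hs => hasDerivAt_entropyPrimitive hx hy hs)
    (fun s (hs : 0 < s) => by positivity) (tendsto_entropyPrimitive hy)]
  simp only [add_zero, one_mul, zero_mul, div_one, Real.log_div hy.ne' hx.ne']
  ring

end ScalarEntropy

section RelativeEntropy

variable {n : Type*}

theorem convex_posDef : Convex ℝ {A : Matrix n n ℝ | A.PosDef} := by
  intro A hA B hB a b ha hb hab
  rcases ha.eq_or_lt with rfl | ha
  · obtain rfl : b = 1 := by simpa using hab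
    simpa using hB
  · exact (hA.smul ha).add_posSemidef (hB.posSemidef.smul hb)

variable [Fintype n]

/-- The functional, linear in `(M, A)`, whose supremum over `Z` is `chiSqDiv s M A`. -/
noncomputable def chiSqFunctional (s : ℝ) (Z M A : Matrix n n ℝ) : ℝ :=
  2 * ((M * Zᵀ).trace - (A * Zᵀ).trace) - (M * Z * Zᵀ).trace - s * (Z * A * Zᵀ).trace

/-- A quantum `χ²`-type divergence of `M` from `A`. It is defined by its variational formula, from
which joint convexity is immediate; for commuting `M` and `A` with joint eigenvalues `x` and `y` it
is the sum of the `(x - y) ^ 2 / (x + s * y)`. -/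
noncomputable def chiSqDiv (s : ℝ) (M A : Matrix n n ℝ) : ℝ := ⨆ Z, chiSqFunctional s Z M A

theorem chiSqFunctional_combo (s a b : ℝ) (Z M₁ M₂ A₁ A₂ : Matrix n n ℝ) :
    chiSqFunctional s Z (a • M₁ + b • M₂) (a • A₁ + b • A₂) =
      a * chiSqFunctional s Z M₁ A₁ + b * chiSqFunctional s Z M₂ A₂ := by
  simp only [chiSqFunctional, Matrix.add_mul, Matrix.mul_add, Matrix.smul_mul, Matrix.mul_smul,
    Matrix.trace_add, Matrix.trace_smul, smul_eq_mul]
  ring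

variable [DecidableEq n] {M A : Matrix n n ℝ}

/-- The quantum relative entropy `tr (M log M - M log A - M + A)`, meant for positive definite
matrices. -/
noncomputable def relEntropy (M A : Matrix n n ℝ) : ℝ :=
  (M * CFC.log M).trace - (M * CFC.log A).trace - M.trace + A.trace

theorem chiSqFunctional_eq_sum (s : ℝ) (Z : Matrix n n ℝ) (hM : M.IsHermitian)
    (hA : A.IsHermitian) :
    chiSqFunctional s Z M A = ∑ i, ∑ j,
      (2 * (hM.eigenvalues i - hA.eigenvalues j) * eigenCoeff hM hA 1 i j * eigenCoeff hM hA Z i j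
        - (hM.eigenvalues i + s * hA.eigenvalues j) * eigenCoeff hM hA Z i j ^ 2) := by
  have hM1 := trace_mul_mul_transpose_left hM hA 1 Z
  have hA1 := trace_mul_mul_transpose_right hM hA 1 Z
  rw [Matrix.mul_one] at hM1
  rw [Matrix.one_mul] at hA1
  rw [chiSqFunctional, hM1, hA1, trace_mul_mul_transpose_left hM hA Z Z,
    trace_mul_mul_transpose_right hM hA Z Z]
  simp only [Finset.mul_sum, ← Finset.sum_sub_distrib]
  refine Finset.sum_congr rfl fun i _ => Finset.sum_congr rfl fun j _ => ?_
  ring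

theorem isGreatest_range_chiSqFunctional {s : ℝ} (hs : 0 ≤ s) (hM : M.PosDef) (hA : A.PosDef) :
    IsGreatest (Set.range fun Z => chiSqFunctional s Z M A)
      (∑ i, ∑ j, eigenCoeff hM.1 hA.1 1 i j ^ 2 *
        ((hM.1.eigenvalues i - hA.1.eigenvalues j) ^ 2 /
          (hM.1.eigenvalues i + s * hA.1.eigenvalues j))) := by
  have den_pos (i j) : 0 < hM.1.eigenvalues i + s * hA.1.eigenvalues j := by
    have := hM.eigenvalues_pos i
    have := hA.eigenvalues_pos j
    positivity
  have complete_square {c d p z : ℝ} (hp : 0 < p) :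
      2 * d * c * z - p * z ^ 2 = c ^ 2 * (d ^ 2 / p) - (c * d - p * z) ^ 2 / p := by
    field_simp
    ring
  constructor
  · obtain ⟨Z, hZ⟩ := surjective_eigenCoeff hM.1 hA.1 <| Matrix.of fun i j =>
      eigenCoeff hM.1 hA.1 1 i j * (hM.1.eigenvalues i - hA.1.eigenvalues j) /
        (hM.1.eigenvalues i + s * hA.1.eigenvalues j)
    refine ⟨Z, ?_⟩
    simp only [chiSqFunctional_eq_sum s _ hM.1 hA.1, complete_square (den_pos _ _), hZ,
      Matrix.of_apply, mul_div_cancel₀ _ (den_pos _ _).ne']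
    simp
  · rintro _ ⟨Z, rfl⟩
    simp only [chiSqFunctional_eq_sum s _ hM.1 hA.1]
    refine Finset.sum_le_sum fun i _ => Finset.sum_le_sum fun j _ => ?_
    rw [complete_square (den_pos i j)]
    exact sub_le_self _ (div_nonneg (sq_nonneg _) (den_pos i j).le)

theorem chiSqDiv_eq_sum {s : ℝ} (hs : 0 ≤ s) (hM : M.PosDef) (hA : A.PosDef) :
    chiSqDiv s M A = ∑ i, ∑ j, eigenCoeff hM.1 hA.1 1 i j ^ 2 *
      ((hM.1.eigenvalues i - hA.1.eigenvalues j) ^ 2 /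
        (hM.1.eigenvalues i + s * hA.1.eigenvalues j)) :=
  (isGreatest_range_chiSqFunctional hs hM hA).csSup_eq

omit [DecidableEq n] in
theorem convexOn_chiSqDiv {s : ℝ} (hs : 0 ≤ s) :
    ConvexOn ℝ ({A : Matrix n n ℝ | A.PosDef} ×ˢ {A | A.PosDef})
      fun p => chiSqDiv s p.1 p.2 := by
  classical
  refine ⟨convex_posDef.prod convex_posDef, ?_⟩
  rintro ⟨M₁, A₁⟩ ⟨hM₁, hA₁⟩ ⟨M₂, A₂⟩ ⟨hM₂, hA₂⟩ a b ha hb -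
  refine ciSup_le fun Z => (chiSqFunctional_combo s a b Z M₁ M₂ A₁ A₂).trans_le ?_
  simp only [smul_eq_mul]
  gcongr
  · exact le_ciSup (isGreatest_range_chiSqFunctional hs hM₁ hA₁).bddAbove Z
  · exact le_ciSup (isGreatest_range_chiSqFunctional hs hM₂ hA₂).bddAbove Z

theorem relEntropy_eq_sum (hM : M.IsHermitian) (hA : A.IsHermitian) :
    relEntropy M A = ∑ i, ∑ j, eigenCoeff hM hA 1 i j ^ 2 *
      (hM.eigenvalues i * Real.log (hM.eigenvalues i) -
        hM.eigenvalues i * Real.log (hA.eigenvalues j) -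
        hM.eigenvalues i + hA.eigenvalues j) := by
  have mul_log : M * CFC.log M = cfc (fun x => x * Real.log x) M := by
    rw [cfc_mul (fun x => x) _ M (by fun_prop) (M.finite_real_spectrum.continuousOn _),
      cfc_id' ℝ M hM.isSelfAdjoint, CFC.log]
  have h1 := trace_cfc_mul_cfc hM hA (fun x => x * Real.log x) (fun _ => 1) 1 1
  have h2 := trace_cfc_mul_cfc hM hA (fun x => x) Real.log 1 1
  have h3 := trace_mul_mul_transpose_left hM hA 1 1
  have h4 := trace_mul_mul_transpose_right hM hA 1 1
  simp only [cfc_const_one ℝ A hA.isSelfAdjoint, cfc_id' ℝ M hM.isSelfAdjoint, Matrix.mul_one,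
    Matrix.one_mul, Matrix.transpose_one] at h1 h2 h3 h4
  rw [relEntropy, mul_log, h1, CFC.log, h2, h3, h4]
  simp only [← Finset.sum_sub_distrib, ← Finset.sum_add_distrib]
  refine Finset.sum_congr rfl fun i _ => Finset.sum_congr rfl fun j _ => ?_
  ring

theorem weight_mul_chiSqDiv {s : ℝ} (hs : 0 ≤ s) (hM : M.PosDef) (hA : A.PosDef) :
    s / (1 + s) ^ 2 * chiSqDiv s M A =
      ∑ i, ∑ j, eigenCoeff hM.1 hA.1 1 i j ^ 2 * (s / (1 + s) ^ 2 *
        ((hM.1.eigenvalues i - hA.1.eigenvalues j) ^ 2 /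
          (hM.1.eigenvalues i + s * hA.1.eigenvalues j))) := by
  simp only [chiSqDiv_eq_sum hs hM hA, Finset.mul_sum]
  exact Finset.sum_congr rfl fun i _ => Finset.sum_congr rfl fun j _ => mul_left_comm _ _ _

omit [DecidableEq n] in
theorem integrableOn_chiSqDiv (hM : M.PosDef) (hA : A.PosDef) :
    IntegrableOn (fun s => s / (1 + s) ^ 2 * chiSqDiv s M A) (Set.Ioi 0) := by
  classical
  refine IntegrableOn.congr_fun ?_
    (fun s (hs : 0 < s) => (weight_mul_chiSqDiv hs.le hM hA).symm) measurableSet_Ioi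
  exact integrable_finsetSum _ fun i _ => integrable_finsetSum _ fun j _ =>
    (integrableOn_entropyIntegrand (hM.eigenvalues_pos i) (hA.eigenvalues_pos j)).const_mul _

theorem integral_chiSqDiv (hM : M.PosDef) (hA : A.PosDef) :
    ∫ s in Set.Ioi (0 : ℝ), s / (1 + s) ^ 2 * chiSqDiv s M A = relEntropy M A := by
  have hint (i j) := (integrableOn_entropyIntegrand (hM.eigenvalues_pos i)
    (hA.eigenvalues_pos j)).const_mul (eigenCoeff hM.1 hA.1 1 i j ^ 2)
  rw [setIntegral_congr_fun measurableSet_Ioi fun s (hs : 0 < s) =>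
      weight_mul_chiSqDiv hs.le hM hA,
    relEntropy_eq_sum hM.1 hA.1,
    integral_finsetSum _ fun i _ => integrable_finsetSum _ fun j _ => hint i j]
  refine Finset.sum_congr rfl fun i _ => ?_
  rw [integral_finsetSum _ fun j _ => hint i j]
  refine Finset.sum_congr rfl fun j _ => ?_
  rw [integral_const_mul,
    integral_entropyIntegrand (hM.eigenvalues_pos i) (hA.eigenvalues_pos j)]

theorem convexOn_relEntropy :
    ConvexOn ℝ ({A : Matrix n n ℝ | A.PosDef} ×ˢ {A | A.PosDef})
      fun p => relEntropy p.1 p.2 := by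
  refine ⟨convex_posDef.prod convex_posDef, ?_⟩
  rintro ⟨M₁, A₁⟩ ⟨hM₁, hA₁⟩ ⟨M₂, A₂⟩ ⟨hM₂, hA₂⟩ a b ha hb hab
  have hM : (a • M₁ + b • M₂).PosDef := convex_posDef hM₁ hM₂ ha hb hab
  have hA : (a • A₁ + b • A₂).PosDef := convex_posDef hA₁ hA₂ ha hb hab
  have i₁ := (integrableOn_chiSqDiv hM₁ hA₁).const_mul a
  have i₂ := (integrableOn_chiSqDiv hM₂ hA₂).const_mul b
  simp only [Prod.smul_mk, Prod.mk_add_mk, smul_eq_mul]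
  rw [← integral_chiSqDiv hM hA, ← integral_chiSqDiv hM₁ hA₁, ← integral_chiSqDiv hM₂ hA₂,
    ← integral_const_mul, ← integral_const_mul, ← integral_add i₁ i₂]
  refine setIntegral_mono_on (integrableOn_chiSqDiv hM hA) (i₁.add i₂) measurableSet_Ioi
    fun s hs => ?_
  have hs : 0 ≤ s := le_of_lt hs
  calc _ ≤ s / (1 + s) ^ 2 * (a * chiSqDiv s M₁ A₁ + b * chiSqDiv s M₂ A₂) := by
        gcongr
        exact (convexOn_chiSqDiv hs).2 ⟨hM₁, hA₁⟩ ⟨hM₂, hA₂⟩ ha hb hab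
    _ = _ := by ring

theorem relEntropy_nonneg (hM : M.PosDef) (hA : A.PosDef) : 0 ≤ relEntropy M A := by
  rw [← integral_chiSqDiv hM hA]
  refine setIntegral_nonneg measurableSet_Ioi fun s (hs : 0 < s) => ?_
  have : 0 ≤ chiSqDiv s M A :=
    le_ciSup_of_le (isGreatest_range_chiSqFunctional hs.le hM hA).bddAbove 0
      (by simp [chiSqFunctional])
  positivity

end RelativeEntropy

/-! ### Lieb's concavity theorem -/

section TraceExp

variable {n : Type*} [Fintype n] [DecidableEq n] {A B H : Matrix n n ℝ}

theorem isHermitian_log (A : Matrix n n ℝ) : (CFC.log A).IsHermitian :=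
  (IsSelfAdjoint.log (a := A)).isHermitian

theorem posDef_exp (hA : A.IsHermitian) : (exp A).PosDef := by
  rw [← Matrix.isStrictlyPositive_iff_posDef]
  exact (Matrix.isUnit_exp A).isStrictlyPositive hA.isSelfAdjoint.exp_nonneg

theorem relEntropy_exp (M : Matrix n n ℝ) (hB : B.IsHermitian) :
    relEntropy M (exp B) =
      (M * CFC.log M).trace - (M * B).trace - M.trace + (exp B).trace := by
  rw [relEntropy, CFC.log_exp B hB.isSelfAdjoint]

theorem trace_exp_mono (hA : A.IsHermitian) (hB : B.IsHermitian) (hAB : A ≤ B) :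
    (exp A).trace ≤ (exp B).trace := by
  have klein := relEntropy_nonneg (posDef_exp hA) (posDef_exp hB)
  rw [relEntropy_exp _ hB, CFC.log_exp _ hA.isSelfAdjoint] at klein
  have pairing := trace_mul_nonneg (posDef_exp hA).posSemidef (Matrix.le_iff.mp hAB)
  rw [Matrix.mul_sub, Matrix.trace_sub] at pairing
  linarith

theorem concaveOn_trace_exp_add_log (hH : H.IsHermitian) :
    ConcaveOn ℝ {A : Matrix n n ℝ | A.PosDef} fun A => (exp (H + CFC.log A)).trace := by
  refine ⟨convex_posDef, fun A₁ hA₁ A₂ hA₂ a b ha hb hab => ?_⟩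
  have hlog (A : Matrix n n ℝ) : (H + CFC.log A).IsHermitian := hH.add (isHermitian_log A)
  set M₁ := exp (H + CFC.log A₁)
  set M₂ := exp (H + CFC.log A₂)
  have pos₁ : M₁.PosDef := posDef_exp (hlog A₁)
  have pos₂ : M₂.PosDef := posDef_exp (hlog A₂)
  -- Gibbs variational principle: `M₁` and `M₂` maximize `tr M - relEntropy M A + tr (M H)` for
  -- `A = A₁, A₂`; at the combined `A` it suffices to test with `a • M₁ + b • M₂`.
  have gibbs := relEntropy_nonneg (convex_posDef pos₁ pos₂ ha hb hab)
    (posDef_exp (hlog (a • A₁ + b • A₂)))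
  rw [relEntropy_exp _ (hlog _)] at gibbs
  have convexity := convexOn_relEntropy.2 (x := (M₁, A₁)) (y := (M₂, A₂))
    ⟨pos₁, hA₁⟩ ⟨pos₂, hA₂⟩ ha hb hab
  have log₁ : CFC.log M₁ = H + CFC.log A₁ := CFC.log_exp _ (hlog A₁).isSelfAdjoint
  have log₂ : CFC.log M₂ = H + CFC.log A₂ := CFC.log_exp _ (hlog A₂).isSelfAdjoint
  simp only [Prod.smul_mk, Prod.mk_add_mk, relEntropy, log₁, log₂, Matrix.mul_add, Matrix.add_mul,
    Matrix.smul_mul, Matrix.trace_add, Matrix.trace_smul, smul_eq_mul] at gibbs convexity ⊢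
  linarith

theorem trace_exp_eq_sum (hA : A.IsHermitian) (θ : ℝ) :
    (exp (θ • A)).trace = ∑ i, Real.exp (θ * hA.eigenvalues i) := by
  have exp_eq : exp (θ • A) = cfc (fun x => Real.exp (θ * x)) A := by
    rw [← CFC.real_exp_eq_normedSpace_exp (hA.smul (.all θ)).isSelfAdjoint,
      ← cfc_comp_const_mul θ Real.exp A (Real.continuous_exp.continuousOn) hA.isSelfAdjoint]
  rw [exp_eq, trace_cfc hA]

theorem trace_exp_smul_one (c : ℝ) :
    (exp (c • (1 : Matrix n n ℝ))).trace = Fintype.card n * Real.exp c := by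
  have h : (c • (1 : Matrix n n ℝ)).IsHermitian := Matrix.isHermitian_one.smul (.all c)
  rw [← CFC.real_exp_eq_normedSpace_exp h.isSelfAdjoint, ← Algebra.algebraMap_eq_smul_one,
    cfc_algebraMap, Algebra.algebraMap_eq_smul_one]
  simp [Matrix.trace_smul, mul_comm]

theorem exp_mul_norm_le [Nonempty n] (hA : A.IsHermitian) {θ : ℝ} (hθ : 0 ≤ θ) :
    Real.exp (θ * ‖A‖) ≤ (exp (θ • A)).trace + (exp ((-θ) • A)).trace := by
  obtain ⟨x, hx, hxA⟩ := (IsometricContinuousFunctionalCalculus.isGreatest_norm_spectrum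
    (𝕜 := ℝ) A hA.isSelfAdjoint).1
  rw [hA.spectrum_real_eq_range_eigenvalues] at hx
  obtain ⟨i, rfl⟩ := hx
  have le_trace (c : ℝ) : Real.exp (c * hA.eigenvalues i) ≤ (exp (c • A)).trace := by
    rw [trace_exp_eq_sum hA]
    exact Finset.single_le_sum (f := fun i => Real.exp (c * hA.eigenvalues i))
      (fun _ _ => (Real.exp_pos _).le) (Finset.mem_univ i)
  rw [← hxA]
  calc Real.exp (θ * |hA.eigenvalues i|)
    _ = Real.exp |θ * hA.eigenvalues i| := by rw [abs_mul, abs_of_nonneg hθ]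
    _ ≤ Real.exp (θ * hA.eigenvalues i) + Real.exp (-θ * hA.eigenvalues i) := by
      rw [neg_mul]
      exact Real.exp_abs_le _
    _ ≤ _ := add_le_add (le_trace θ) (le_trace (-θ))

theorem continuous_exp : Continuous (exp : Matrix n n ℝ → Matrix n n ℝ) :=
  letI : NormedAlgebra ℚ (Matrix n n ℝ) := NormedAlgebra.restrictScalars ℚ ℝ _
  NormedSpace.exp_continuous

theorem continuous_trace_exp_add (H : Matrix n n ℝ) :
    Continuous fun A : Matrix n n ℝ => (exp (H + A)).trace :=
  (continuous_exp.comp (continuous_const.add continuous_id)).matrix_trace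

theorem continuousOn_log :
    ContinuousOn (CFC.log : Matrix n n ℝ → Matrix n n ℝ) {A | A.PosDef} :=
  CFC.continuousOn_log.mono fun _ hA => ⟨hA.1.isSelfAdjoint, hA.isUnit⟩

end TraceExp

/-! ### Order intervals of matrices -/

section Order

instance orderClosedTopology_matrix {n : Type*} [Finite n] :
    OrderClosedTopology (Matrix n n ℝ) := by
  cases nonempty_fintype n
  refine ⟨?_⟩
  simp only [Matrix.le_iff, Matrix.posSemidef_iff_dotProduct_mulVec, Set.ofPred_and,
    Set.ofPred_forall]
  exact (isClosed_eq (by fun_prop) (by fun_prop)).inter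
    (isClosed_iInter fun x => isClosed_le (by fun_prop) (by fun_prop))

theorem isHermitian_of_le {n : Type*} {A B : Matrix n n ℝ} (hA : A.IsHermitian) (hAB : A ≤ B) :
    B.IsHermitian := by
  simpa only [add_sub_cancel] using hA.add (Matrix.le_iff.1 hAB).1

variable {n : Type*} [DecidableEq n] {A : Matrix n n ℝ} {a b : ℝ}

theorem isHermitian_of_mem_Icc (hA : A ∈ Set.Icc (a • (1 : Matrix n n ℝ)) (b • 1)) :
    A.IsHermitian :=
  isHermitian_of_le (Matrix.isHermitian_one.smul (.all a)) hA.1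

theorem posDef_of_mem_Icc (ha : 0 < a) (hA : A ∈ Set.Icc (a • (1 : Matrix n n ℝ)) (b • 1)) :
    A.PosDef := by
  have h := (Matrix.PosDef.one.smul ha).add_posSemidef (Matrix.le_iff.1 hA.1)
  rwa [add_sub_cancel] at h

variable [Fintype n]

theorem mem_Icc_smul_one_iff (hA : A.IsHermitian) :
    A ∈ Set.Icc (a • (1 : Matrix n n ℝ)) (b • 1) ↔ spectrum ℝ A ⊆ Set.Icc a b := by
  rw [Set.mem_Icc, ← Algebra.algebraMap_eq_smul_one, ← Algebra.algebraMap_eq_smul_one,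
    algebraMap_le_iff_le_spectrum (ha := hA.isSelfAdjoint),
    le_algebraMap_iff_spectrum_le (ha := hA.isSelfAdjoint)]
  exact forall₂_and.symm

theorem spectrum_subset_of_mem_Icc (hA : A ∈ Set.Icc (a • (1 : Matrix n n ℝ)) (b • 1)) :
    spectrum ℝ A ⊆ Set.Icc a b :=
  (mem_Icc_smul_one_iff (isHermitian_of_mem_Icc hA)).1 hA

omit [Fintype n] in
theorem isCompact_Icc_smul_one [Finite n] :
    IsCompact (Set.Icc (a • (1 : Matrix n n ℝ)) (b • 1)) := by
  cases nonempty_fintype n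
  refine (Metric.isCompact_iff_isClosed_bounded).2
    ⟨isClosed_Icc, isBounded_iff_forall_norm_le.2 ⟨max |a| |b|, fun A hA => ?_⟩⟩
  rw [← cfc_id ℝ A (isHermitian_of_mem_Icc hA).isSelfAdjoint]
  refine norm_cfc_le (by positivity) fun x hx => ?_
  obtain ⟨hax, hxb⟩ := spectrum_subset_of_mem_Icc hA hx
  exact abs_le_max_abs_abs hax hxb

variable {Ω : Type*} [MeasurableSpace Ω] {P : Measure Ω}

omit [Fintype n] in
theorem integrable_comp_of_ae_mem_Icc [Finite n] [IsFiniteMeasure P] {E : Type*}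
    [NormedAddCommGroup E] {f : Matrix n n ℝ → E}
    (hf : ContinuousOn f (Set.Icc (a • 1) (b • 1))) {X : Ω → Matrix n n ℝ}
    (hXm : AEStronglyMeasurable X P)
    (hX : ∀ᵐ ω ∂P, X ω ∈ Set.Icc (a • (1 : Matrix n n ℝ)) (b • 1)) :
    Integrable (fun ω => f (X ω)) P := by
  cases nonempty_fintype n
  borelize (Matrix n n ℝ)
  have hXm := hXm.aemeasurable
  have hf_map := hf.integrableOn_compact (μ := P.map X) isCompact_Icc_smul_one
  have hX_map : ∀ᵐ A ∂P.map X, A ∈ Set.Icc (a • (1 : Matrix n n ℝ)) (b • 1) :=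
    (ae_map_iff hXm measurableSet_Icc).2 hX
  rw [IntegrableOn, Measure.restrict_eq_self_of_ae_mem hX_map] at hf_map
  exact hf_map.comp_aemeasurable hXm

theorem integrable_of_ae_mem_Icc [IsFiniteMeasure P] {X : Ω → Matrix n n ℝ}
    (hXm : AEStronglyMeasurable X P)
    (hX : ∀ᵐ ω ∂P, X ω ∈ Set.Icc (a • (1 : Matrix n n ℝ)) (b • 1)) : Integrable X P :=
  integrable_comp_of_ae_mem_Icc continuousOn_id hXm hX

theorem integral_mem_Icc [IsProbabilityMeasure P] {X : Ω → Matrix n n ℝ}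
    (hXm : AEStronglyMeasurable X P)
    (hX : ∀ᵐ ω ∂P, X ω ∈ Set.Icc (a • (1 : Matrix n n ℝ)) (b • 1)) :
    P[X] ∈ Set.Icc (a • (1 : Matrix n n ℝ)) (b • 1) :=
  (convex_Icc _ _).integral_mem isClosed_Icc hX (integrable_of_ae_mem_Icc hXm hX)

end Order

/-! ### Subadditivity of matrix cumulant generating functions -/

section TraceMGF

variable {n : Type*} [Fintype n] [DecidableEq n] {Ω Ω' : Type*} [MeasurableSpace Ω]
  [MeasurableSpace Ω'] {P : Measure Ω} {Q : Measure Ω'} {X : Ω → Matrix n n ℝ}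
  {Y : Ω' → Matrix n n ℝ} {Λ Λ' : Matrix n n ℝ}

/-- `Λ` bounds the cumulant generating function of the random Hermitian matrix `X` inside every
trace exponential. The quantification over the shifts `H` is what makes such bounds additive over
independent summands, although `exp (X + Y) ≠ exp X * exp Y`. -/
structure HasTraceMGFBound (X : Ω → Matrix n n ℝ) (Λ : Matrix n n ℝ) (P : Measure Ω) : Prop where
  isHermitian : ∀ᵐ ω ∂P, (X ω).IsHermitian
  isHermitian_bound : Λ.IsHermitian
  integrable {H : Matrix n n ℝ} : H.IsHermitian → Integrable (fun ω => (exp (H + X ω)).trace) P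
  integral_le {H : Matrix n n ℝ} : H.IsHermitian →
    ∫ ω, (exp (H + X ω)).trace ∂P ≤ (exp (H + Λ)).trace

namespace HasTraceMGFBound

theorem zero [IsProbabilityMeasure P] :
    HasTraceMGFBound (fun _ => 0 : Ω → Matrix n n ℝ) 0 P where
  isHermitian := .of_forall fun _ => Matrix.isHermitian_zero
  isHermitian_bound := Matrix.isHermitian_zero
  integrable _ := integrable_const _
  integral_le _ := by simp

theorem mono (h : HasTraceMGFBound X Λ P) (hΛ : Λ ≤ Λ') : HasTraceMGFBound X Λ' P where
  isHermitian := h.isHermitian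
  isHermitian_bound := isHermitian_of_le h.isHermitian_bound hΛ
  integrable := h.integrable
  integral_le hH := (h.integral_le hH).trans <|
    trace_exp_mono (hH.add h.isHermitian_bound)
      (hH.add (isHermitian_of_le h.isHermitian_bound hΛ)) (by gcongr)

theorem sub_const (h : HasTraceMGFBound X Λ P) {C : Matrix n n ℝ} (hC : C.IsHermitian) :
    HasTraceMGFBound (fun ω => X ω - C) (Λ - C) P where
  isHermitian := h.isHermitian.mono fun _ hω => hω.sub hC
  isHermitian_bound := h.isHermitian_bound.sub hC
  integrable {H} hH := by
    simpa only [add_sub_assoc, sub_add_eq_add_sub] using h.integrable (hH.sub hC)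
  integral_le {H} hH := by
    simpa only [add_sub_assoc, sub_add_eq_add_sub] using h.integral_le (hH.sub hC)

theorem prod [SFinite Q] [SFinite P] (hX : HasTraceMGFBound X Λ P)
    (hY : HasTraceMGFBound Y Λ' Q) (hXm : AEStronglyMeasurable X P)
    (hYm : AEStronglyMeasurable Y Q) :
    HasTraceMGFBound (fun p : Ω × Ω' => X p.1 + Y p.2) (Λ + Λ') (P.prod Q) := by
  have trace_nonneg {A : Matrix n n ℝ} (hA : A.IsHermitian) : 0 ≤ (exp A).trace :=
    (posDef_exp hA).posSemidef.trace_nonneg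
  have inner_integrable {H : Matrix n n ℝ} (hH : H.IsHermitian) :
      ∀ᵐ ω ∂P, Integrable (fun ω' => (exp (H + (X ω + Y ω'))).trace) Q := by
    filter_upwards [hX.isHermitian] with ω hω
    simpa only [add_assoc] using hY.integrable (hH.add hω)
  have inner_le {H : Matrix n n ℝ} (hH : H.IsHermitian) :
      ∀ᵐ ω ∂P, ∫ ω', (exp (H + (X ω + Y ω'))).trace ∂Q ≤ (exp (H + Λ' + X ω)).trace := by
    filter_upwards [hX.isHermitian] with ω hω
    simpa only [add_assoc, add_comm (X ω) Λ'] using hY.integral_le (hH.add hω)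
  have product_integrable {H : Matrix n n ℝ} (hH : H.IsHermitian) :
      Integrable (fun p : Ω × Ω' => (exp (H + (X p.1 + Y p.2))).trace) (P.prod Q) := by
    have hm : AEStronglyMeasurable (fun p : Ω × Ω' => (exp (H + (X p.1 + Y p.2))).trace)
        (P.prod Q) := (continuous_trace_exp_add H).comp_aestronglyMeasurable
      (hXm.comp_fst.add hYm.comp_snd)
    refine (integrable_prod_iff hm).2 ⟨inner_integrable hH,
      (hX.integrable (hH.add hY.isHermitian_bound)).mono' hm.norm.integral_prod_right' ?_⟩
    filter_upwards [hX.isHermitian, inner_le hH] with ω hω hle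
    rw [Real.norm_of_nonneg (integral_nonneg fun _ => norm_nonneg _)]
    refine (integral_congr_ae ?_).trans_le hle
    filter_upwards [hY.isHermitian] with ω' hω'
    exact Real.norm_of_nonneg (trace_nonneg (hH.add (hω.add hω')))
  refine ⟨?_, hX.isHermitian_bound.add hY.isHermitian_bound, product_integrable, fun {H} hH => ?_⟩
  · filter_upwards [Measure.quasiMeasurePreserving_fst.ae hX.isHermitian,
      Measure.quasiMeasurePreserving_snd.ae hY.isHermitian] with p hp hp' using hp.add hp'
  calc ∫ p : Ω × Ω', (exp (H + (X p.1 + Y p.2))).trace ∂P.prod Q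
    _ = ∫ ω, ∫ ω', (exp (H + (X ω + Y ω'))).trace ∂Q ∂P := integral_prod _ (product_integrable hH)
    _ ≤ ∫ ω, (exp (H + Λ' + X ω)).trace ∂P :=
      integral_mono_ae (product_integrable hH).integral_prod_left
        (hX.integrable (hH.add hY.isHermitian_bound)) (inner_le hH)
    _ ≤ (exp (H + Λ' + Λ)).trace := hX.integral_le (hH.add hY.isHermitian_bound)
    _ = (exp (H + (Λ + Λ'))).trace := by rw [add_assoc, add_comm Λ']

variable [MeasurableSpace (Matrix n n ℝ)] [BorelSpace (Matrix n n ℝ)]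

theorem map_iff {T : Ω → Ω'} (hT : AEMeasurable T P) (hY : Measurable Y) :
    HasTraceMGFBound Y Λ (P.map T) ↔ HasTraceMGFBound (fun ω => Y (T ω)) Λ P := by
  have hermitian_iff :
      (∀ᵐ ω' ∂P.map T, (Y ω').IsHermitian) ↔ ∀ᵐ ω ∂P, (Y (T ω)).IsHermitian :=
    ae_map_iff hT <| hY <| (isClosed_eq (by fun_prop) (by fun_prop) :
      IsClosed {A : Matrix n n ℝ | Aᴴ = A}).measurableSet
  have hm (H : Matrix n n ℝ) :
      AEStronglyMeasurable (fun ω' => (exp (H + Y ω')).trace) (P.map T) :=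
    (continuous_trace_exp_add H).comp_aestronglyMeasurable hY.aestronglyMeasurable
  refine ⟨fun h => ⟨hermitian_iff.1 h.isHermitian, h.isHermitian_bound, fun {H} hH => ?_,
    fun {H} hH => ?_⟩, fun h => ⟨hermitian_iff.2 h.isHermitian, h.isHermitian_bound,
    fun {H} hH => ?_, fun {H} hH => ?_⟩⟩
  · exact (integrable_map_measure (hm H) hT).1 (h.integrable hH)
  · exact (integral_map hT (hm H)).symm.trans_le (h.integral_le hH)
  · exact (integrable_map_measure (hm H) hT).2 (h.integrable hH)
  · exact (integral_map hT (hm H)).trans_le (h.integral_le hH)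

theorem add_of_indepFun [IsProbabilityMeasure P] {X Y : Ω → Matrix n n ℝ}
    (hX : HasTraceMGFBound X Λ P) (hY : HasTraceMGFBound Y Λ' P) (hXm : AEMeasurable X P)
    (hYm : AEMeasurable Y P) (hXY : IndepFun X Y P) :
    HasTraceMGFBound (fun ω => X ω + Y ω) (Λ + Λ') P := by
  have : IsProbabilityMeasure (P.map X) := Measure.isProbabilityMeasure_map hXm
  have : IsProbabilityMeasure (P.map Y) := Measure.isProbabilityMeasure_map hYm
  have joint := prod ((map_iff hXm measurable_id).2 hX) ((map_iff hYm measurable_id).2 hY)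
    aestronglyMeasurable_id aestronglyMeasurable_id
  rw [← (indepFun_iff_map_prod_eq_prod_map_map hXm hYm).1 hXY] at joint
  exact (map_iff (hXm.prodMk hYm) (measurable_fst.add measurable_snd)).1 joint

theorem sum_of_iIndepFun [IsProbabilityMeasure P] {ι : Type*} {X : ι → Ω → Matrix n n ℝ}
    {Λ : ι → Matrix n n ℝ} (hindep : iIndepFun X P) (hXm : ∀ i, AEMeasurable (X i) P)
    {s : Finset ι} (hX : ∀ i ∈ s, HasTraceMGFBound (X i) (Λ i) P) :
    HasTraceMGFBound (fun ω => ∑ i ∈ s, X i ω) (∑ i ∈ s, Λ i) P := by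
  classical
  induction s using Finset.induction_on with
  | empty => simpa only [Finset.sum_empty] using zero
  | insert i s hi ih =>
    obtain ⟨hXi, hXs⟩ := Finset.forall_mem_insert i s _ |>.1 hX
    simp only [Finset.sum_insert hi]
    refine hXi.add_of_indepFun (ih hXs) (hXm i)
      (Finset.aemeasurable_fun_sum s fun j _ => hXm j) ?_
    simpa only [← Finset.sum_apply] using (hindep.indepFun_finsetSum_of_notMem₀ hXm hi).symm

end HasTraceMGFBound

theorem hasTraceMGFBound_log_integral [IsProbabilityMeasure P] {B : Ω → Matrix n n ℝ} {b c : ℝ}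
    (hb : 0 < b) (hBm : AEStronglyMeasurable B P)
    (hB : ∀ᵐ ω ∂P, B ω ∈ Set.Icc (b • (1 : Matrix n n ℝ)) (c • 1))
    (hXm : AEStronglyMeasurable X P) (hX : ∀ᵐ ω ∂P, (X ω).IsHermitian)
    (hXB : ∀ᵐ ω ∂P, X ω ≤ CFC.log (B ω)) :
    HasTraceMGFBound X (CFC.log P[B]) P := by
  have subset_posDef : Set.Icc (b • (1 : Matrix n n ℝ)) (c • 1) ⊆ {A | A.PosDef} :=
    fun _ hA => posDef_of_mem_Icc hb hA
  have continuousOn_lieb (H : Matrix n n ℝ) :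
      ContinuousOn (fun A => (exp (H + CFC.log A)).trace) (Set.Icc (b • 1) (c • 1)) :=
    (continuous_trace_exp_add H).comp_continuousOn (continuousOn_log.mono subset_posDef)
  have hB_int := integrable_of_ae_mem_Icc hBm hB
  have hlog_int (H : Matrix n n ℝ) := integrable_comp_of_ae_mem_Icc (continuousOn_lieb H) hBm hB
  have hle {H : Matrix n n ℝ} (hH : H.IsHermitian) :
      ∀ᵐ ω ∂P, (exp (H + X ω)).trace ≤ (exp (H + CFC.log (B ω))).trace := by
    filter_upwards [hX, hXB] with ω hω hle
    exact trace_exp_mono (hH.add hω) (hH.add (isHermitian_log _)) (by gcongr)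
  have hX_int {H : Matrix n n ℝ} (hH : H.IsHermitian) :
      Integrable (fun ω => (exp (H + X ω)).trace) P := by
    refine (hlog_int H).mono' ((continuous_trace_exp_add H).comp_aestronglyMeasurable hXm) ?_
    filter_upwards [hX, hle hH] with ω hω hle
    rwa [Real.norm_of_nonneg (posDef_exp (hH.add hω)).posSemidef.trace_nonneg]
  refine ⟨hX, isHermitian_log _, hX_int, fun {H} hH => ?_⟩
  calc ∫ ω, (exp (H + X ω)).trace ∂P
    _ ≤ ∫ ω, (exp (H + CFC.log (B ω))).trace ∂P :=
      integral_mono_ae (hX_int hH) (hlog_int H) (hle hH)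
    _ ≤ (exp (H + CFC.log P[B])).trace :=
      ((concaveOn_trace_exp_add_log hH).subset subset_posDef (convex_Icc _ _)).le_map_integral
        (continuousOn_lieb H) isClosed_Icc hB hB_int (hlog_int H)

end TraceMGF

/-! ### The matrix Hoeffding inequality -/

section ExpSecant

variable {a b x : ℝ}

/-- The affine function that interpolates the exponential at `a` and `b`. It is affine also in a
matrix argument, hence commutes with expectations. -/
noncomputable def expSecant (a b x : ℝ) : ℝ := Real.exp a + slope Real.exp a b * (x - a)

theorem expSecant_combo (a b p : ℝ) :
    expSecant a b ((1 - p) * a + p * b) = (1 - p) * Real.exp a + p * Real.exp b := by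
  have h := sub_smul_slope Real.exp a b
  rw [smul_eq_mul, vsub_eq_sub] at h
  rw [expSecant]
  linear_combination p * h

theorem exists_eq_combo_of_mem_Icc (hx : x ∈ Set.Icc a b) :
    ∃ p ∈ Set.Icc (0 : ℝ) 1, (1 - p) * a + p * b = x := by
  rw [← segment_eq_Icc (hx.1.trans hx.2), segment_eq_image] at hx
  exact hx

theorem exp_le_expSecant (hx : x ∈ Set.Icc a b) : Real.exp x ≤ expSecant a b x := by
  obtain ⟨p, hp, rfl⟩ := exists_eq_combo_of_mem_Icc hx
  rw [expSecant_combo]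
  exact convexOn_exp.2 trivial trivial (sub_nonneg.2 hp.2) hp.1 (sub_add_cancel 1 p)

theorem expSecant_mem_Icc (hx : x ∈ Set.Icc a b) :
    expSecant a b x ∈ Set.Icc (Real.exp a) (Real.exp b) := by
  have hab : Real.exp a ≤ Real.exp b := Real.exp_le_exp.2 (hx.1.trans hx.2)
  obtain ⟨p, hp, rfl⟩ := exists_eq_combo_of_mem_Icc hx
  rw [expSecant_combo, ← segment_eq_Icc hab]
  exact ⟨1 - p, p, sub_nonneg.2 hp.2, hp.1, sub_add_cancel 1 p, rfl⟩

theorem two_point_exp_le {p : ℝ} (hab : a ≤ b) (hp : p ∈ Set.Icc (0 : ℝ) 1) :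
    (1 - p) * Real.exp a + p * Real.exp b ≤
      Real.exp ((1 - p) * a + p * b + (b - a) ^ 2 / 8) := by
  let μ : Measure ℝ := ENNReal.ofReal (1 - p) • .dirac a + ENNReal.ofReal p • .dirac b
  have integral_eq (f : ℝ → ℝ) : ∫ x, f x ∂μ = (1 - p) * f a + p * f b := by
    rw [integral_add_measure (integrable_dirac (by simp) |>.smul_measure (by simp))
      (integrable_dirac (by simp) |>.smul_measure (by simp))]
    simp [integral_smul_measure, hp.1, hp.2]
  have : IsProbabilityMeasure μ := ⟨by
    simp only [μ, Measure.coe_add, Measure.coe_smul, Pi.add_apply, Pi.smul_apply, measure_univ,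
      smul_eq_mul, mul_one]
    rw [← ENNReal.ofReal_add (sub_nonneg.2 hp.2) hp.1, sub_add_cancel, ENNReal.ofReal_one]⟩
  have mem_Icc : ∀ᵐ x ∂μ, id x ∈ Set.Icc a b :=
    ae_add_measure_iff.2 ⟨Measure.ae_smul_measure (by simp [ae_dirac_eq, hab]) _,
      Measure.ae_smul_measure (by simp [ae_dirac_eq, hab]) _⟩
  have hoeffding := (hasSubgaussianMGF_of_mem_Icc aemeasurable_id mem_Icc).mgf_le 1
  rw [mgf, integral_eq, integral_eq] at hoeffding
  simp only [id_eq, one_mul, one_pow, mul_one, Real.exp_sub, ← mul_div_assoc, ← add_div]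
    at hoeffding
  rw [div_le_iff₀ (Real.exp_pos _), ← Real.exp_add] at hoeffding
  refine hoeffding.trans_eq (congrArg Real.exp ?_)
  simp only [NNReal.coe_pow, NNReal.coe_div, coe_nnnorm, Real.norm_eq_abs, NNReal.coe_ofNat,
    div_pow, sq_abs]
  ring

theorem expSecant_le_exp (hx : x ∈ Set.Icc a b) :
    expSecant a b x ≤ Real.exp (x + (b - a) ^ 2 / 8) := by
  have hab := hx.1.trans hx.2
  obtain ⟨p, hp, rfl⟩ := exists_eq_combo_of_mem_Icc hx
  rw [expSecant_combo]
  exact two_point_exp_le hab hp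

theorem expSecant_pos (hx : x ∈ Set.Icc a b) : 0 < expSecant a b x :=
  (Real.exp_pos a).trans_le (expSecant_mem_Icc hx).1

end ExpSecant

section HoeffdingLemma

variable {n : Type*} [Fintype n] [DecidableEq n] {A : Matrix n n ℝ} {a b : ℝ}

theorem cfc_expSecant (hA : A.IsHermitian) :
    cfc (expSecant a b) A = Real.exp a • 1 + slope Real.exp a b • (A - a • 1) := by
  have cont (f : ℝ → ℝ) := A.finite_real_spectrum.continuousOn f
  unfold expSecant
  rw [cfc_const_add _ _ A (cont _) hA.isSelfAdjoint, cfc_const_mul _ _ A (cont _),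
    cfc_sub _ _ A (cont _) (cont _), cfc_id' ℝ A hA.isSelfAdjoint,
    cfc_const _ A hA.isSelfAdjoint, Algebra.algebraMap_eq_smul_one, Algebra.algebraMap_eq_smul_one]

theorem cfc_expSecant_mem_Icc (hA : A ∈ Set.Icc (a • (1 : Matrix n n ℝ)) (b • 1)) :
    cfc (expSecant a b) A ∈ Set.Icc (Real.exp a • (1 : Matrix n n ℝ)) (Real.exp b • 1) := by
  have hAH := (isHermitian_of_mem_Icc hA).isSelfAdjoint
  rw [mem_Icc_smul_one_iff (cfc_predicate _ A : IsSelfAdjoint _).isHermitian,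
    cfc_map_spectrum _ A hAH (A.finite_real_spectrum.continuousOn _)]
  rintro _ ⟨x, hx, rfl⟩
  exact expSecant_mem_Icc (spectrum_subset_of_mem_Icc hA hx)

theorem log_cfc_expSecant (hA : A ∈ Set.Icc (a • (1 : Matrix n n ℝ)) (b • 1)) :
    CFC.log (cfc (expSecant a b) A) = cfc (fun x => Real.log (expSecant a b x)) A := by
  refine (cfc_comp' Real.log _ A (Real.continuousOn_log.mono ?_)
    (A.finite_real_spectrum.continuousOn _) (isHermitian_of_mem_Icc hA).isSelfAdjoint).symm
  rintro _ ⟨x, hx, rfl⟩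
  exact (expSecant_pos (spectrum_subset_of_mem_Icc hA hx)).ne'

theorem le_log_cfc_expSecant (hA : A ∈ Set.Icc (a • (1 : Matrix n n ℝ)) (b • 1)) :
    A ≤ CFC.log (cfc (expSecant a b) A) := by
  have cont (f : ℝ → ℝ) := A.finite_real_spectrum.continuousOn f
  rw [log_cfc_expSecant hA]
  nth_rw 1 [← cfc_id' ℝ A (isHermitian_of_mem_Icc hA).isSelfAdjoint]
  refine cfc_mono (fun x hx => ?_) (cont _) (cont _)
  have hx := spectrum_subset_of_mem_Icc hA hx
  exact (Real.le_log_iff_exp_le (expSecant_pos hx)).2 (exp_le_expSecant hx)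

theorem log_cfc_expSecant_le (hA : A ∈ Set.Icc (a • (1 : Matrix n n ℝ)) (b • 1)) :
    CFC.log (cfc (expSecant a b) A) ≤ A + ((b - a) ^ 2 / 8) • 1 := by
  have cont (f : ℝ → ℝ) := A.finite_real_spectrum.continuousOn f
  have hAH := (isHermitian_of_mem_Icc hA).isSelfAdjoint
  have rhs : A + ((b - a) ^ 2 / 8) • 1 = cfc (fun x => x + (b - a) ^ 2 / 8) A := by
    rw [cfc_add_const _ _ A (cont _) hAH, cfc_id' ℝ A hAH, Algebra.algebraMap_eq_smul_one]
  rw [log_cfc_expSecant hA, rhs]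
  refine cfc_mono (fun x hx => ?_) (cont _) (cont _)
  have hx := spectrum_subset_of_mem_Icc hA hx
  exact (Real.log_le_iff_le_exp (expSecant_pos hx)).2 (expSecant_le_exp hx)

variable {Ω : Type*} [MeasurableSpace Ω] {P : Measure Ω} [IsProbabilityMeasure P]
  {X : Ω → Matrix n n ℝ}

theorem integral_cfc_expSecant (hXm : AEStronglyMeasurable X P)
    (hX : ∀ᵐ ω ∂P, X ω ∈ Set.Icc (a • (1 : Matrix n n ℝ)) (b • 1)) :
    ∫ ω, cfc (expSecant a b) (X ω) ∂P = cfc (expSecant a b) P[X] := by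
  have hX_int := integrable_of_ae_mem_Icc hXm hX
  have affine : ∀ᵐ ω ∂P, cfc (expSecant a b) (X ω) =
      Real.exp a • 1 + slope Real.exp a b • (X ω - a • 1) :=
    hX.mono fun ω hω => cfc_expSecant (isHermitian_of_mem_Icc hω)
  have hsmul_int : Integrable (fun ω => slope Real.exp a b • (X ω - a • 1)) P :=
    (hX_int.sub (integrable_const _)).smul (slope Real.exp a b)
  have integral_const_eq (C : Matrix n n ℝ) : ∫ _, C ∂P = C := by
    rw [integral_const, probReal_univ, one_smul]
  rw [integral_congr_ae affine, integral_add (integrable_const _) hsmul_int, integral_const_eq,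
    integral_smul, integral_sub hX_int (integrable_const _), integral_const_eq,
    cfc_expSecant (isHermitian_of_mem_Icc (integral_mem_Icc hXm hX))]

theorem hasTraceMGFBound_sub_integral (hXm : AEStronglyMeasurable X P)
    (hX : ∀ᵐ ω ∂P, X ω ∈ Set.Icc (a • (1 : Matrix n n ℝ)) (b • 1)) :
    HasTraceMGFBound (fun ω => X ω - P[X]) (((b - a) ^ 2 / 8) • 1) P := by
  have mean_mem := integral_mem_Icc hXm hX
  have secant_meas : AEStronglyMeasurable (fun ω => cfc (expSecant a b) (X ω)) P := by
    refine AEStronglyMeasurable.congr (f := fun ω =>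
      Real.exp a • 1 + slope Real.exp a b • (X ω - a • 1)) (by fun_prop) ?_
    exact hX.mono fun ω hω => (cfc_expSecant (isHermitian_of_mem_Icc hω)).symm
  have bound : HasTraceMGFBound X (CFC.log (cfc (expSecant a b) P[X])) P := by
    rw [← integral_cfc_expSecant hXm hX]
    exact hasTraceMGFBound_log_integral (Real.exp_pos a) secant_meas
      (hX.mono fun _ => cfc_expSecant_mem_Icc) hXm (hX.mono fun _ => isHermitian_of_mem_Icc)
      (hX.mono fun _ => le_log_cfc_expSecant)
  refine (bound.sub_const (isHermitian_of_mem_Icc mean_mem)).mono ?_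
  rw [sub_le_iff_le_add']
  exact log_cfc_expSecant_le mean_mem

theorem hasTraceMGFBound_smul_sub_integral (hXm : AEStronglyMeasurable X P)
    (hX : ∀ᵐ ω ∂P, X ω ∈ Set.Icc (a • (1 : Matrix n n ℝ)) (b • 1)) (θ : ℝ) :
    HasTraceMGFBound (fun ω => θ • (X ω - P[X])) ((θ ^ 2 * (b - a) ^ 2 / 8) • 1) P := by
  simp only [smul_sub, ← integral_smul]
  rcases le_total 0 θ with hθ | hθ
  · have hθX : ∀ᵐ ω ∂P, θ • X ω ∈ Set.Icc ((θ * a) • (1 : Matrix n n ℝ)) ((θ * b) • 1) :=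
      hX.mono fun ω hω => by
        simp only [mul_smul]
        exact ⟨smul_le_smul_of_nonneg_left hω.1 hθ, smul_le_smul_of_nonneg_left hω.2 hθ⟩
    have width_sq : (θ * b - θ * a) ^ 2 = θ ^ 2 * (b - a) ^ 2 := by ring
    simpa only [width_sq, Pi.smul_apply] using
      hasTraceMGFBound_sub_integral (hXm.const_smul θ) hθX
  · have hθX : ∀ᵐ ω ∂P, θ • X ω ∈ Set.Icc ((θ * b) • (1 : Matrix n n ℝ)) ((θ * a) • 1) :=
      hX.mono fun ω hω => by
        simp only [mul_smul]
        exact ⟨smul_le_smul_of_nonpos_left hω.2 hθ, smul_le_smul_of_nonpos_left hω.1 hθ⟩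
    have width_sq : (θ * a - θ * b) ^ 2 = θ ^ 2 * (b - a) ^ 2 := by ring
    simpa only [width_sq, Pi.smul_apply] using
      hasTraceMGFBound_sub_integral (hXm.const_smul θ) hθX

end HoeffdingLemma

section HoeffdingInequality

variable {n : Type*} [Fintype n] [DecidableEq n] [Nonempty n] {Ω : Type*} [MeasurableSpace Ω]
  {P : Measure Ω} [IsProbabilityMeasure P]

theorem HasTraceMGFBound.measureReal_le_norm_le {S : Ω → Matrix n n ℝ} {θ v : ℝ} (hθ : 0 ≤ θ)
    (hS : ∀ᵐ ω ∂P, (S ω).IsHermitian)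
    (hpos : HasTraceMGFBound (fun ω => θ • S ω) (v • 1) P)
    (hneg : HasTraceMGFBound (fun ω => (-θ) • S ω) (v • 1) P) (t : ℝ) :
    P.real {ω | t ≤ ‖S ω‖} ≤ 2 * Fintype.card n * Real.exp (v - θ * t) := by
  let g ω := (exp (θ • S ω)).trace + (exp ((-θ) • S ω)).trace
  have integral_trace {c : ℝ} (h : HasTraceMGFBound (fun ω => c • S ω) (v • 1) P) :
      Integrable (fun ω => (exp (c • S ω)).trace) P ∧
        ∫ ω, (exp (c • S ω)).trace ∂P ≤ Fintype.card n * Real.exp v := by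
    have h_int := h.integrable Matrix.isHermitian_zero
    have h_le := h.integral_le Matrix.isHermitian_zero
    simp only [zero_add, trace_exp_smul_one] at h_int h_le
    exact ⟨h_int, h_le⟩
  obtain ⟨int_pos, le_pos⟩ := integral_trace hpos
  obtain ⟨int_neg, le_neg⟩ := integral_trace hneg
  have exp_norm_le : ∀ᵐ ω ∂P, Real.exp (θ * ‖S ω‖) ≤ g ω :=
    hS.mono fun ω hω => exp_mul_norm_le hω hθ
  have markov : Real.exp (θ * t) * P.real {ω | Real.exp (θ * t) ≤ g ω} ≤ ∫ ω, g ω ∂P :=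
    mul_meas_ge_le_integral_of_nonneg
      (exp_norm_le.mono fun ω hω => (Real.exp_pos _).le.trans hω) (int_pos.add int_neg) _
  have tail_le : P.real {ω | t ≤ ‖S ω‖} ≤ P.real {ω | Real.exp (θ * t) ≤ g ω} := by
    refine ENNReal.toReal_mono (measure_ne_top _ _) (measure_mono_ae ?_)
    filter_upwards [exp_norm_le] with ω hω (ht : t ≤ ‖S ω‖)
    exact (Real.exp_le_exp.2 (by gcongr)).trans hω
  rw [Real.exp_sub, ← mul_div_assoc, le_div_iff₀' (Real.exp_pos _)]
  calc Real.exp (θ * t) * P.real {ω | t ≤ ‖S ω‖}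
    _ ≤ Real.exp (θ * t) * P.real {ω | Real.exp (θ * t) ≤ g ω} := by gcongr
    _ ≤ ∫ ω, g ω ∂P := markov
    _ ≤ Fintype.card n * Real.exp v + Fintype.card n * Real.exp v :=
      (integral_add int_pos int_neg).trans_le (add_le_add le_pos le_neg)
    _ = 2 * Fintype.card n * Real.exp v := by ring

variable [MeasurableSpace (Matrix n n ℝ)] [BorelSpace (Matrix n n ℝ)]

theorem measureReal_le_norm_sum_sub_integral_le {ι : Type*} {X : ι → Ω → Matrix n n ℝ}
    (hindep : iIndepFun X P) (hXm : ∀ i, AEMeasurable (X i) P) {s : Finset ι} {a b : ι → ℝ}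
    (hX : ∀ i ∈ s, ∀ᵐ ω ∂P, X i ω ∈ Set.Icc (a i • (1 : Matrix n n ℝ)) (b i • 1))
    {t : ℝ} (ht : 0 ≤ t) :
    P.real {ω | t ≤ ‖∑ i ∈ s, (X i ω - P[X i])‖} ≤
      2 * Fintype.card n * Real.exp (-2 * t ^ 2 / ∑ i ∈ s, (b i - a i) ^ 2) := by
  set V := ∑ i ∈ s, (b i - a i) ^ 2 with hV
  have V_nonneg : 0 ≤ V := Finset.sum_nonneg fun i _ => sq_nonneg _
  have bound (θ : ℝ) : HasTraceMGFBound (fun ω => θ • ∑ i ∈ s, (X i ω - P[X i]))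
      ((θ ^ 2 * V / 8) • 1) P := by
    have hindep_smul : iIndepFun (fun i ω => θ • (X i ω - P[X i])) P :=
      hindep.comp (fun i A => θ • (A - ∫ ω, X i ω ∂P)) fun i => by fun_prop
    have hsum := HasTraceMGFBound.sum_of_iIndepFun hindep_smul (fun i => by fun_prop) fun i hi =>
      hasTraceMGFBound_smul_sub_integral (hXm i).aestronglyMeasurable (hX i hi) θ
    simpa only [← Finset.smul_sum, ← Finset.sum_smul, ← Finset.sum_div,
      ← Finset.mul_sum, ← hV] using hsum
  have hermitian : ∀ᵐ ω ∂P, (∑ i ∈ s, (X i ω - P[X i])).IsHermitian := by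
    simpa only [one_smul] using (bound 1).isHermitian
  -- `θ = 4 * t / V` minimizes the exponent `θ ^ 2 * V / 8 - θ * t`; for `V = 0` it is `0`.
  have tail := HasTraceMGFBound.measureReal_le_norm_le (θ := 4 * t / V)
    (div_nonneg (by positivity) V_nonneg) hermitian (bound _)
    (by simpa only [neg_sq] using bound (-(4 * t / V))) t
  refine tail.trans_eq ?_
  congr 2
  rcases eq_or_ne V 0 with hV0 | hV0
  · simp [hV0]
  · field_simp
    ring

end HoeffdingInequality

end MatrixConcentration

/-! ### The empirical covariance of the watermark -/

namespace DynamicWatermark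

open MatrixConcentration
open scoped MatrixOrder

section Outer

variable {q : ℕ}

theorem outer_eq_vecMulVec (v : EuclideanSpace ℝ (Fin q)) : outer v = Matrix.vecMulVec v v := rfl

theorem dotProduct_self_eq_norm_sq (v : EuclideanSpace ℝ (Fin q)) :
    (v : Fin q → ℝ) ⬝ᵥ v = ‖v‖ ^ 2 := by
  rw [EuclideanSpace.real_norm_sq_eq]
  simp only [dotProduct, sq]

theorem continuous_outer : Continuous (outer : EuclideanSpace ℝ (Fin q) → _) :=
  continuous_matrix fun i j => by
    simp only [outer_eq_vecMulVec, Matrix.vecMulVec_apply]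
    fun_prop

theorem outer_zero : outer (0 : EuclideanSpace ℝ (Fin q)) = 0 :=
  Matrix.zero_vecMulVec _

theorem trace_outer (v : EuclideanSpace ℝ (Fin q)) : (outer v).trace = ‖v‖ ^ 2 := by
  rw [outer_eq_vecMulVec, Matrix.trace_vecMulVec, dotProduct_self_eq_norm_sq]

theorem outer_sq (v : EuclideanSpace ℝ (Fin q)) : outer v ^ 2 = ‖v‖ ^ 2 • outer v := by
  rw [sq, outer_eq_vecMulVec, Matrix.vecMulVec_mul_vecMulVec, dotProduct_self_eq_norm_sq,
    Matrix.vecMulVec_smul]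

theorem dotProduct_outer_mulVec (v : EuclideanSpace ℝ (Fin q)) (x : Fin q → ℝ) :
    x ⬝ᵥ (outer v *ᵥ x) = ((v : Fin q → ℝ) ⬝ᵥ x) ^ 2 := by
  rw [outer_eq_vecMulVec, Matrix.vecMulVec_mulVec, op_smul_eq_smul, dotProduct_smul, smul_eq_mul,
    dotProduct_comm x, sq]

theorem posSemidef_outer (v : EuclideanSpace ℝ (Fin q)) : (outer v).PosSemidef :=
  Matrix.posSemidef_vecMulVec_self_star (v : Fin q → ℝ)

theorem outer_le_smul_one {v : EuclideanSpace ℝ (Fin q)} {K : ℝ} (hv : ‖v‖ ≤ K) :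
    outer v ≤ K ^ 2 • 1 := by
  rw [Matrix.le_iff, Matrix.posSemidef_iff_dotProduct_mulVec]
  refine ⟨(Matrix.isHermitian_one.smul (.all _)).sub (posSemidef_outer v).isHermitian, fun x => ?_⟩
  rw [star_trivial, Matrix.sub_mulVec, dotProduct_sub, dotProduct_outer_mulVec, Matrix.smul_mulVec,
    Matrix.one_mulVec, dotProduct_smul, smul_eq_mul, sub_nonneg]
  calc ((v : Fin q → ℝ) ⬝ᵥ x) ^ 2
    _ ≤ (∑ i, v i ^ 2) * ∑ i, x i ^ 2 := Finset.sum_mul_sq_le_sq_mul_sq _ _ _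
    _ = ‖v‖ ^ 2 * (x ⬝ᵥ x) := by
      rw [EuclideanSpace.real_norm_sq_eq]
      simp only [dotProduct, sq]
    _ ≤ K ^ 2 * (x ⬝ᵥ x) := by
      gcongr
      exact Finset.sum_nonneg fun i _ => mul_self_nonneg _

theorem outer_mem_Icc {v : EuclideanSpace ℝ (Fin q)} {K : ℝ} (hv : ‖v‖ ≤ K) :
    outer v ∈ Set.Icc ((0 : ℝ) • (1 : Matrix (Fin q) (Fin q) ℝ)) (K ^ 2 • 1) := by
  rw [zero_smul]
  exact ⟨(posSemidef_outer v).nonneg, outer_le_smul_one hv⟩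

theorem sq_smul_one_sub (c : ℝ) (A : Matrix (Fin q) (Fin q) ℝ) :
    (c • 1 - A) ^ 2 = c ^ 2 • 1 - (2 * c) • A + A ^ 2 := by
  simp only [sq, sub_mul, mul_sub, smul_mul_assoc, mul_smul_comm, one_mul, mul_one]
  module

theorem trace_sq_smul_one_sub_outer (c : ℝ) (v : EuclideanSpace ℝ (Fin q)) :
    ((c • 1 - outer v) ^ 2).trace = (q - 1) * c ^ 2 + (c - ‖v‖ ^ 2) ^ 2 := by
  simp only [sq_smul_one_sub, outer_sq, Matrix.trace_add, Matrix.trace_sub, Matrix.trace_smul,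
    Matrix.trace_one, trace_outer, Fintype.card_fin, smul_eq_mul]
  ring

theorem abs_diag_le_norm (A : Matrix (Fin q) (Fin q) ℝ) (i : Fin q) : |A i i| ≤ ‖A‖ := by
  have h := Matrix.l2_opNorm_mulVec A (EuclideanSpace.single i 1)
  rw [PiLp.norm_single, norm_one, mul_one] at h
  refine le_trans ?_ ((PiLp.norm_apply_le _ i).trans h)
  simp [Real.norm_eq_abs]

theorem trace_le_mul_norm (A : Matrix (Fin q) (Fin q) ℝ) : A.trace ≤ q * ‖A‖ := by
  simpa [Matrix.trace] using
    Finset.sum_le_card_nsmul Finset.univ _ ‖A‖ fun i _ =>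
      (le_abs_self _).trans (abs_diag_le_norm A i)

end Outer

section Moments

variable {Ω : Type*} [MeasurableSpace Ω] {P : Measure Ω} {q : ℕ}
  {X : Ω → EuclideanSpace ℝ (Fin q)} {K : ℝ}

theorem integral_matrix_apply {M : Ω → Matrix (Fin q) (Fin q) ℝ} (hM : Integrable M P)
    (i j : Fin q) : (∫ ω, M ω ∂P) i j = ∫ ω, M ω i j ∂P :=
  ((Matrix.entryLinearMap ℝ ℝ i j).toContinuousLinearMap.integral_comp_comm hM).symm

theorem matrixExp_eq_integral {M : Ω → Matrix (Fin q) (Fin q) ℝ} (hM : Integrable M P) :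
    matrixExp P M = ∫ ω, M ω ∂P := by
  ext i j
  exact (integral_matrix_apply hM i j).symm

theorem integrable_comp_outer [IsFiniteMeasure P] (hXm : AEStronglyMeasurable X P)
    (hX : ∀ᵐ ω ∂P, ‖X ω‖ ≤ K) {E : Type*} [NormedAddCommGroup E]
    {f : Matrix (Fin q) (Fin q) ℝ → E} (hf : Continuous f) :
    Integrable (fun ω => f (outer (X ω))) P :=
  integrable_comp_of_ae_mem_Icc hf.continuousOn (continuous_outer.comp_aestronglyMeasurable hXm)
    (hX.mono fun _ => outer_mem_Icc)

theorem covMatrix_eq_integral_outer [IsFiniteMeasure P] (hXm : AEStronglyMeasurable X P)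
    (hX : ∀ᵐ ω ∂P, ‖X ω‖ ≤ K) (hmean : P[X] = 0) : covMatrix P X = ∫ ω, outer (X ω) ∂P := by
  have mean_apply (i : Fin q) : ∫ ω, X ω i ∂P = 0 := by
    have h := (EuclideanSpace.proj (𝕜 := ℝ) i).integral_comp_comm (Integrable.of_bound hXm K hX)
    rwa [hmean, map_zero] at h
  ext i j
  rw [integral_matrix_apply (integrable_comp_outer hXm hX continuous_id')]
  simp only [covMatrix, Matrix.of_apply, covariance, mean_apply, sub_zero, outer]

theorem integral_comp_outer_eq {Y : Ω → EuclideanSpace ℝ (Fin q)} (hXY : IdentDistrib X Y P P)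
    {f : Matrix (Fin q) (Fin q) ℝ → Matrix (Fin q) (Fin q) ℝ} (hf : Continuous f) :
    ∫ ω, f (outer (X ω)) ∂P = ∫ ω, f (outer (Y ω)) ∂P := by
  borelize (Matrix (Fin q) (Fin q) ℝ)
  exact (hXY.comp (hf.comp continuous_outer).measurable).integral_eq

variable [IsProbabilityMeasure P]

theorem sq_sub_covMatrix_add_matrixExp_sub (hXm : AEStronglyMeasurable X P)
    (hX : ∀ᵐ ω ∂P, ‖X ω‖ ≤ K) (hmean : P[X] = 0) (c : ℝ) :
    (c • 1 - covMatrix P X) ^ 2 + matrixExp P (fun ω => outer (X ω) ^ 2) - covMatrix P X ^ 2 =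
      ∫ ω, (c • 1 - outer (X ω)) ^ 2 ∂P := by
  have int_comp {f : Matrix (Fin q) (Fin q) ℝ → Matrix (Fin q) (Fin q) ℝ} (hf : Continuous f) :
      Integrable (fun ω => f (outer (X ω))) P := integrable_comp_outer hXm hX hf
  have int_smul := int_comp (continuous_const_smul (2 * c))
  have int_sq := int_comp (continuous_pow 2)
  have int_affine := int_comp (f := fun A => c ^ 2 • 1 - (2 * c) • A) (by fun_prop)
  rw [covMatrix_eq_integral_outer hXm hX hmean, matrixExp_eq_integral int_sq, sq_smul_one_sub]
  simp only [sq_smul_one_sub]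
  rw [integral_add int_affine int_sq, integral_sub (integrable_const _) int_smul, integral_const,
    probReal_univ, one_smul, integral_smul]
  abel

theorem sub_one_mul_sq_le_mul_norm_integral_sq (hXm : AEStronglyMeasurable X P)
    (hX : ∀ᵐ ω ∂P, ‖X ω‖ ≤ K) (c : ℝ) :
    (q - 1) * c ^ 2 ≤ q * ‖∫ ω, (c • 1 - outer (X ω)) ^ 2 ∂P‖ := by
  have int_sq : Integrable (fun ω => (c • 1 - outer (X ω)) ^ 2) P :=
    integrable_comp_outer hXm hX (f := fun A => (c • 1 - A) ^ 2) (by fun_prop)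
  let traceCLM := (Matrix.traceLinearMap (Fin q) ℝ ℝ).toContinuousLinearMap
  calc (q - 1) * c ^ 2
    _ = ∫ _, (q - 1) * c ^ 2 ∂P := by simp
    _ ≤ ∫ ω, ((c • 1 - outer (X ω)) ^ 2).trace ∂P := by
      refine integral_mono (integrable_const _) (traceCLM.integrable_comp int_sq) fun ω => ?_
      dsimp only
      rw [trace_sq_smul_one_sub_outer]
      exact le_add_of_nonneg_right (sq_nonneg _)
    _ = (∫ ω, (c • 1 - outer (X ω)) ^ 2 ∂P).trace := traceCLM.integral_comp_comm int_sq
    _ ≤ q * ‖∫ ω, (c • 1 - outer (X ω)) ^ 2 ∂P‖ := trace_le_mul_norm _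

end Moments

section Watermark

variable {Ω : Type*} [MeasurableSpace Ω] {P : Measure Ω} [IsProbabilityMeasure P] {q : ℕ}
  {e : ℤ → Ω → EuclideanSpace ℝ (Fin q)} {K : ℝ}

theorem c3_eq_mul_norm_integral (hident : ∀ n, IdentDistrib (e n) (e 0) P P)
    (hbound : ∀ n, ∀ᵐ ω ∂P, ‖e n ω‖ ≤ K) (hmean : P[e 0] = 0) (N : ℕ) :
    c3 P e K N = N * ‖∫ ω, (K ^ 2 • 1 - outer (e 0 ω)) ^ 2 ∂P‖ := by
  have hmeas (n : ℤ) := (hident n).aemeasurable_fst.aestronglyMeasurable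
  have matrixExp_eq (n : ℤ) : (matrixExp P fun ω => outer (e n ω) ^ 2) =
      matrixExp P fun ω => outer (e 0 ω) ^ 2 := by
    rw [matrixExp_eq_integral (integrable_comp_outer (hmeas n) (hbound n) (continuous_pow 2)),
      matrixExp_eq_integral (integrable_comp_outer (hmeas 0) (hbound 0) (continuous_pow 2)),
      integral_comp_outer_eq (hident n) (continuous_pow 2)]
  simp only [c3, matrixExp_eq]
  rw [sq_sub_covMatrix_add_matrixExp_sub (hmeas 0) (hbound 0) hmean, Finset.sum_const,
    Finset.card_range, ← Nat.cast_smul_eq_nsmul ℝ, norm_smul, Real.norm_natCast]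

theorem mul_pow_div_two_le_c3 (hq : 2 ≤ q) (hident : ∀ n, IdentDistrib (e n) (e 0) P P)
    (hbound : ∀ n, ∀ᵐ ω ∂P, ‖e n ω‖ ≤ K) (hmean : P[e 0] = 0) (N : ℕ) :
    N * (K ^ 4 / 2) ≤ c3 P e K N := by
  have hq : (2 : ℝ) ≤ q := by exact_mod_cast hq
  have hmeas := (hident 0).aemeasurable_fst.aestronglyMeasurable
  have trace_bound := sub_one_mul_sq_le_mul_norm_integral_sq hmeas (hbound 0) (K ^ 2)
  rw [c3_eq_mul_norm_integral hident hbound hmean]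
  gcongr
  refine le_of_mul_le_mul_left (trace_bound.trans' ?_) (by positivity : (0 : ℝ) < q)
  nlinarith [pow_nonneg (sq_nonneg K) 2]

theorem c3_pos (hq : 2 ≤ q) (hident : ∀ n, IdentDistrib (e n) (e 0) P P)
    (hbound : ∀ n, ∀ᵐ ω ∂P, ‖e n ω‖ ≤ K) (hmean : P[e 0] = 0) {N : ℕ} (hN : 1 ≤ N) (hK : 0 < K) :
    0 < c3 P e K N :=
  (by positivity : 0 < N * (K ^ 4 / 2)).trans_le (mul_pow_div_two_le_c3 hq hident hbound hmean N)

theorem neg_two_mul_sq_div_le_neg_sq_div_c3 (hq : 2 ≤ q)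
    (hident : ∀ n, IdentDistrib (e n) (e 0) P P) (hbound : ∀ n, ∀ᵐ ω ∂P, ‖e n ω‖ ≤ K)
    (hmean : P[e 0] = 0) {N : ℕ} (hN : 1 ≤ N) (hK : 0 < K) (t : ℝ) :
    -2 * N * t ^ 2 / K ^ 4 ≤ -(N ^ 2 * t ^ 2) / c3 P e K N := by
  calc -2 * N * t ^ 2 / K ^ 4
    _ = -(N ^ 2 * t ^ 2 / (N * (K ^ 4 / 2))) := by field_simp
    _ ≤ -(N ^ 2 * t ^ 2 / c3 P e K N) := by
      gcongr
      exact mul_pow_div_two_le_c3 hq hident hbound hmean N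
    _ = -(N ^ 2 * t ^ 2) / c3 P e K N := (neg_div _ _).symm

theorem measureReal_le_norm_Phi3_le [NeZero q] (hindep : iIndepFun e P)
    (hident : ∀ n, IdentDistrib (e n) (e 0) P P) (hbound : ∀ n, ∀ᵐ ω ∂P, ‖e n ω‖ ≤ K)
    (hmean : P[e 0] = 0) (k' : ℕ) {N : ℕ} (hN : 1 ≤ N) {t : ℝ} (ht : 0 ≤ t) :
    P.real {ω | t ≤ ‖Phi3 P e k' N ω‖} ≤ 2 * q * Real.exp (-2 * N * t ^ 2 / K ^ 4) := by
  borelize (Matrix (Fin q) (Fin q) ℝ)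
  have hN : (0 : ℝ) < N := by exact_mod_cast hN
  let shift (n : ℕ) : ℤ := n - k' - 1
  have shift_injective : shift.Injective := fun m n h => by simpa [shift] using h
  let Y (n : ℕ) (ω : Ω) : Matrix (Fin q) (Fin q) ℝ := outer (e (shift n) ω)
  have Y_meas (n : ℕ) : AEMeasurable (Y n) P :=
    continuous_outer.measurable.comp_aemeasurable (hident _).aemeasurable_fst
  have Y_indep : iIndepFun Y P :=
    (hindep.precomp shift_injective).comp (fun _ => outer) fun _ => continuous_outer.measurable
  have hoeffding := measureReal_le_norm_sum_sub_integral_le (s := Finset.range N) Y_indep Y_meas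
    (fun n _ => (hbound (shift n)).mono fun _ => outer_mem_Icc) (mul_nonneg hN.le ht)
  have mean_eq (n : ℕ) : P[Y n] = covMatrix P (e 0) := by
    rw [covMatrix_eq_integral_outer (hident 0).aemeasurable_fst.aestronglyMeasurable (hbound 0)
      hmean]
    exact integral_comp_outer_eq (hident _) continuous_id'
  have norm_iff (ω : Ω) : t ≤ ‖Phi3 P e k' N ω‖ ↔
      N * t ≤ ‖∑ n ∈ Finset.range N, (Y n ω - P[Y n])‖ := by
    rw [Phi3, norm_smul, Real.norm_of_nonneg (by positivity), one_div_mul_eq_div, le_div_iff₀' hN]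
    simp only [mean_eq, Y, shift]
  simp only [norm_iff]
  convert hoeffding using 3
  · rw [Fintype.card_fin]
  · simp only [sub_zero, Finset.sum_const, Finset.card_range, nsmul_eq_mul]
    field_simp

theorem measureReal_le_norm_Phi3_eq_zero (hzero : ∀ n, ∀ᵐ ω ∂P, e n ω = 0) (k' N : ℕ)
    {t : ℝ} (ht : 0 < t) : P.real {ω | t ≤ ‖Phi3 P e k' N ω‖} = 0 := by
  have covMatrix_eq : covMatrix P (e 0) = 0 := by
    have outer_ae : (fun ω => outer (e 0 ω)) =ᵐ[P] 0 :=
      (hzero 0).mono fun ω hω => by simp [hω, outer_zero]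
    rw [covMatrix_eq_integral_outer (K := 0)
      (aestronglyMeasurable_zero.congr (Filter.EventuallyEq.symm (hzero 0)))
      ((hzero 0).mono fun ω hω => by simp [hω]) (integral_eq_zero_of_ae (hzero 0)),
      integral_eq_zero_of_ae outer_ae]
  have norm_lt : ∀ᵐ ω ∂P, ¬ t ≤ ‖Phi3 P e k' N ω‖ := by
    filter_upwards [ae_all_iff.2 hzero] with ω hω
    simp [Phi3, covMatrix_eq, hω, outer_zero, ht]
  rw [measureReal_eq_zero_iff]
  exact measure_eq_zero_iff_ae_notMem.2 norm_lt

end Watermark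

end DynamicWatermark

theorem mainTheorem6 {Ω : Type*} [MeasurableSpace Ω] (P : Measure Ω) [IsProbabilityMeasure P]
    (q : ℕ) (hq : 2 ≤ q) (e : ℤ → Ω → EuclideanSpace ℝ (Fin q)) (Ke : ℝ)
    (hmeas : ∀ n, Measurable (e n))
    (hindep : iIndepFun e P)
    (hident : ∀ n, IdentDistrib (e n) (e 0) P P)
    (hbound : ∀ n, ∀ᵐ ω ∂P, ‖e n ω‖ ≤ Ke)
    (hmean : ∀ n, ∫ ω, e n ω ∂P = 0)
    (k' N : ℕ) (hN : 1 ≤ N) :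
    (∀ t : ℝ, 0 ≤ t →
      P.real {ω | t ≤ ‖DynamicWatermark.Phi3 P e k' N ω‖} ≤
        2 * (q : ℝ) * Real.exp (-((N : ℝ) ^ 2 * t ^ 2) / DynamicWatermark.c3 P e Ke N)) ∧
    (DynamicWatermark.c3 P e Ke N = 0 → ∀ t : ℝ, 0 < t →
      P.real {ω | t ≤ ‖DynamicWatermark.Phi3 P e k' N ω‖} = 0) := by
  have hK : 0 ≤ Ke := (hbound 0).exists.elim fun _ hω => (norm_nonneg _).trans hω
  have tail_eq_zero (h : Ke = 0) {t : ℝ} (ht : 0 < t) :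
      P.real {ω | t ≤ ‖DynamicWatermark.Phi3 P e k' N ω‖} = 0 :=
    DynamicWatermark.measureReal_le_norm_Phi3_eq_zero
      (fun n => (hbound n).mono fun ω hω => norm_le_zero_iff.1 (h ▸ hω)) k' N ht
  refine ⟨fun t ht => ?_, fun hc t ht => tail_eq_zero ?_ ht⟩
  · have : NeZero q := ⟨by omega⟩
    have hoeffding := DynamicWatermark.measureReal_le_norm_Phi3_le hindep hident hbound (hmean 0)
      k' hN ht
    rcases ht.eq_or_lt with rfl | ht
    · simpa using hoeffding
    rcases hK.eq_or_lt with h | hK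
    · rw [tail_eq_zero h.symm ht]
      positivity
    refine hoeffding.trans ?_
    gcongr _ * Real.exp ?_
    exact DynamicWatermark.neg_two_mul_sq_div_le_neg_sq_div_c3 hq hident hbound (hmean 0) hN hK t
  · by_contra hne
    exact (DynamicWatermark.c3_pos hq hident hbound (hmean 0) hN (hK.lt_of_ne' hne)).ne' hc
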